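/- Call a nonempty convex polytope $P \subset \mathbb{R}^d$ an *ideal hyperbolic polytope* (in the projective disk model) if it is contained in the closed unit ball and all its vertices lie on the unit sphere $S^{d-1}$. For $c \in \mathbb{R}^d$ let $P^c$ denote the face of $P$ on which the linear function $x \mapsto \langle c, x\rangle$ attains its maximum over $P$. Two polytopes $Q, Q' \subset \mathbb{R}^d$ are *normally equivalent* if for every $c \in \mathbb{R}^d$ the affine hulls of $Q^c$ and $Q'^c$ differ by a translation. Let $Q, Q' \subset \mathbb{R}^d$ be normally equivalent ideal hyperbolic polytopes that are not of the degenerate form $Q = \{x\}$, $Q' = \{-x\}$. Call the linear function $x\mapsto\langle c, x\rangle$ generic if it has a unique maximizer $q$ over $Q$ and a unique maximizer $q'$ over $Q'$. Then generic linear functions exist, and the angle between $q$ and $q'$ is one and the same number $\theta = \theta(Q,Q') \in [0,\pi)$ for all generic linear functions. Moreover, $$\frac{1}{\sqrt{2 + 2\cos\theta(Q,Q')}}\,(Q + Q')$$ is again an ideal hyperbolic polytope, where $Q+Q'=\{x+x' : x\in Q,\ x'\in Q'\}$ is the Minkowski sum. -/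

import Mathlib

open scoped Pointwise

namespace IdealSum

/-- A (nonempty) convex polytope in `ℝ^d`: the convex hull of a nonempty finite set of points. -/
def IsPolytope {d : ℕ} (P : Set (EuclideanSpace ℝ (Fin d))) : Prop :=
  ∃ s : Set (EuclideanSpace ℝ (Fin d)), s.Finite ∧ s.Nonempty ∧ P = convexHull ℝ s

/-- The face `P^c` of `P`: the points of `P` maximizing the linear function `x ↦ ⟨c, x⟩`. -/
def maxFace {d : ℕ} (P : Set (EuclideanSpace ℝ (Fin d))) (c : EuclideanSpace ℝ (Fin d)) :
    Set (EuclideanSpace ℝ (Fin d)) :=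
  {x | x ∈ P ∧ ∀ y ∈ P, inner ℝ c y ≤ inner ℝ c x}

/-- `P` and `P'` are normally equivalent: for every `c`, the affine hulls of the faces `P^c` and
`P'^c` differ by a translation (this is what `AffineSubspace.Parallel` says). -/
def NormallyEquivalent {d : ℕ} (P P' : Set (EuclideanSpace ℝ (Fin d))) : Prop :=
  ∀ c : EuclideanSpace ℝ (Fin d),
    (affineSpan ℝ (maxFace P c)).Parallel (affineSpan ℝ (maxFace P' c))

/-- An ideal hyperbolic polytope in the projective disk (Beltrami-Klein) model: a polytope
contained in the closed unit ball all of whose vertices lie on the unit sphere. -/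
structure IsIdealPolytope {d : ℕ} (P : Set (EuclideanSpace ℝ (Fin d))) : Prop where
  isPolytope : IsPolytope P
  subset_closedBall : P ⊆ Metric.closedBall 0 1
  vertices_subset_sphere : P.extremePoints ℝ ⊆ Metric.sphere 0 1

/-- The linear function `x ↦ ⟨c, x⟩` is generic for `Q` and `Q'`, and `q`, `q'` are the unique
points (hence vertices) maximizing it over `Q` and over `Q'`, respectively. -/
def AreMaximizers {d : ℕ} (Q Q' : Set (EuclideanSpace ℝ (Fin d)))
    (c q q' : EuclideanSpace ℝ (Fin d)) : Prop :=
  maxFace Q c = {q} ∧ maxFace Q' c = {q'}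

end IdealSum

/-! Normal equivalence matches the vertices `v` of `Q` with vertices `v'` of `Q'` maximizing the
same objectives. Along an edge of `Q` from `v` to `w`, the vector `w' - v'` is a nonzero multiple of
`w - v`. Both chords have unit endpoints, so the reflection in the hyperplane through the origin
normal to them swaps `v`, `w` and also `v'`, `w'`; hence `⟨w, w'⟩ = ⟨v, v'⟩`
(`inner_eq_inner_of_parallel`). Simplex steps along improving edges join any vertex to any other, so
this inner product is a constant `cos θ` (`AreMaximizers.inner_eq`).

Every vertex of `Q + Q'` is some `q + q'` with `q`, `q'` matched, and its squared norm is `2 + 2 cos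
θ`. The value `cos θ = -1` would make all matched pairs antipodal, which forces both polytopes to be
points. -/

namespace IdealSum

/-! ### Faces, pivots and normal equivalence -/

section Faces

variable {d : ℕ} {P P' : Set (EuclideanSpace ℝ (Fin d))} {V V' : Set (EuclideanSpace ℝ (Fin d))}
  {c c₀ v v' w w' : EuclideanSpace ℝ (Fin d)}

theorem inner_le_of_mem_convexHull {M : ℝ} (h : ∀ u ∈ V, inner ℝ c u ≤ M)
    {x : EuclideanSpace ℝ (Fin d)} (hx : x ∈ convexHull ℝ V) : inner ℝ c x ≤ M := by
  have hc : Convex ℝ {x | innerSL ℝ c x ≤ M} :=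
    convex_halfSpace_le (innerSL ℝ c).isLinear M
  exact convexHull_min (fun u hu => h u hu) hc hx

theorem mem_maxFace_convexHull (hv : v ∈ V) (h : ∀ u ∈ V, inner ℝ c u ≤ inner ℝ c v) :
    v ∈ maxFace (convexHull ℝ V) c :=
  ⟨subset_convexHull ℝ V hv, fun _ hy => inner_le_of_mem_convexHull h hy⟩

/-- A maximal face of a convex hull is spanned by the generators on it. -/
theorem mem_convexHull_of_le_inner {M : ℝ} (h : ∀ u ∈ V, inner ℝ c u ≤ M)
    {x : EuclideanSpace ℝ (Fin d)} (hx : x ∈ convexHull ℝ V) (hM : M ≤ inner ℝ c x) :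
    x ∈ convexHull ℝ {u | u ∈ V ∧ inner ℝ c u = M} := by
  set F := {u | u ∈ V ∧ inner ℝ c u = M} with hF
  have hFM : ∀ y ∈ convexHull ℝ F, inner ℝ c y ≤ M := fun y hy =>
    inner_le_of_mem_convexHull (fun u hu => hu.2.le) hy
  -- This set contains `V`, and its convexity needs no coefficients of convex combinations; at
  -- height `M` only its second alternative survives.
  have hconv : Convex ℝ {x | inner ℝ c x < M ∨ x ∈ convexHull ℝ F} := by
    rw [convex_iff_forall_pos]
    intro y hy z hz a b ha hb hab
    have hyM : inner ℝ c y ≤ M := hy.elim le_of_lt (hFM y)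
    have hzM : inner ℝ c z ≤ M := hz.elim le_of_lt (hFM z)
    have hsum : inner ℝ c (a • y + b • z) = a * inner ℝ c y + b * inner ℝ c z := by
      rw [inner_add_right, inner_smul_right, inner_smul_right]
    have hM' : M = a * M + b * M := by rw [← add_mul, hab, one_mul]
    rcases hy with hy | hy
    · left
      rw [hsum, hM']
      exact add_lt_add_of_lt_of_le (mul_lt_mul_of_pos_left hy ha)
        (mul_le_mul_of_nonneg_left hzM hb.le)
    rcases hz with hz | hz
    · left
      rw [hsum, hM']
      exact add_lt_add_of_le_of_lt (mul_le_mul_of_nonneg_left hyM ha.le)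
        (mul_lt_mul_of_pos_left hz hb)
    · right
      exact convex_convexHull ℝ F hy hz ha.le hb.le hab
  have hV : V ⊆ {x | inner ℝ c x < M ∨ x ∈ convexHull ℝ F} := fun u hu =>
    (h u hu).lt_or_eq.imp id fun hu' => subset_convexHull ℝ F ⟨hu, hu'⟩
  exact (convexHull_min hV hconv hx).resolve_left hM.not_gt

theorem maxFace_subset_convexHull :
    maxFace (convexHull ℝ V) c ⊆ convexHull ℝ {u | u ∈ V ∧ u ∈ maxFace (convexHull ℝ V) c} := by
  intro x hx
  refine convexHull_mono ?_ (mem_convexHull_of_le_inner (M := inner ℝ c x)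
    (fun u hu => hx.2 u (subset_convexHull ℝ V hu)) hx.1 le_rfl)
  rintro u ⟨hu, hux⟩
  exact ⟨hu, subset_convexHull ℝ V hu, fun y hy => (hx.2 y hy).trans hux.ge⟩

theorem maxFace_eq_singleton (hv : v ∈ V) (h : ∀ u ∈ V, u ≠ v → inner ℝ c u < inner ℝ c v) :
    maxFace (convexHull ℝ V) c = {v} := by
  have hle : ∀ u ∈ V, inner ℝ c u ≤ inner ℝ c v := fun u hu => by
    rcases eq_or_ne u v with rfl | hne
    · exact le_rfl
    · exact (h u hu hne).le
  refine Set.Subset.antisymm ?_ (Set.singleton_subset_iff.2 (mem_maxFace_convexHull hv hle))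
  refine maxFace_subset_convexHull.trans ?_
  refine (convexHull_mono ?_).trans (convexHull_singleton v).subset
  rintro u ⟨hu, hmax⟩
  by_contra hne
  exact (h u hu hne).not_ge (hmax.2 v (subset_convexHull ℝ V hv))

theorem exists_mem_maxFace (hfin : V.Finite) (hne : V.Nonempty) (c) :
    ∃ v ∈ V, v ∈ maxFace (convexHull ℝ V) c := by
  obtain ⟨v, hv, hmax⟩ := Set.exists_max_image V (fun u => inner ℝ c u) hfin hne
  exact ⟨v, hv, mem_maxFace_convexHull hv hmax⟩

theorem mem_of_maxFace_eq_singleton (hfin : V.Finite) (hne : V.Nonempty)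
    (h : maxFace (convexHull ℝ V) c = {v}) : v ∈ V := by
  obtain ⟨u, hu, hmax⟩ := exists_mem_maxFace hfin hne c
  rw [h] at hmax
  exact hmax ▸ hu

theorem mem_maxFace_of_eq_singleton (h : maxFace P c = {v}) : v ∈ maxFace P c :=
  h ▸ Set.mem_singleton v

theorem inner_lt_of_maxFace_eq_singleton (h : maxFace P c = {v}) (hw : w ∈ P) (hwv : w ≠ v) :
    inner ℝ c w < inner ℝ c v := by
  have hv := mem_maxFace_of_eq_singleton h
  refine (hv.2 w hw).lt_of_ne fun heq => hwv ?_
  have : w ∈ maxFace P c := ⟨hw, fun y hy => (hv.2 y hy).trans heq.ge⟩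
  rwa [h] at this

theorem maxFace_add_smul_eq_singleton {t : ℝ} (ht : 0 ≤ t) (h₀ : maxFace P c₀ = {v})
    (h : v ∈ maxFace P c) : maxFace P (c₀ + t • c) = {v} := by
  have hin : ∀ y, inner ℝ (c₀ + t • c) y = inner ℝ c₀ y + t * inner ℝ c y := fun y => by
    rw [inner_add_left, real_inner_smul_left]
  refine Set.eq_singleton_iff_unique_mem.2 ⟨⟨h.1, fun y hy => ?_⟩, fun y hy => ?_⟩
  · rw [hin, hin]
    exact add_le_add ((mem_maxFace_of_eq_singleton h₀).2 y hy)
      (mul_le_mul_of_nonneg_left (h.2 y hy) ht)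
  · by_contra hne
    have h1 := inner_lt_of_maxFace_eq_singleton h₀ hy.1 hne
    have h2 := mul_le_mul_of_nonneg_left (h.2 y hy.1) ht
    have h3 := hy.2 v h.1
    rw [hin, hin] at h3
    linarith

/-- Moving the objective from `c₀` in direction `c`, a maximizer `v` for `c₀` which is not one for
`c` ties with a generator `w` improving `c` before it ceases to be a maximizer. -/
theorem exists_pivot (hfin : V.Finite) (h₀ : ∀ u ∈ V, inner ℝ c₀ u ≤ inner ℝ c₀ v)
    (hex : ∃ u ∈ V, inner ℝ c v < inner ℝ c u) :
    ∃ t : ℝ, 0 ≤ t ∧ ∃ w ∈ V, inner ℝ c v < inner ℝ c w ∧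
      inner ℝ (c₀ + t • c) w = inner ℝ (c₀ + t • c) v ∧
      ∀ u ∈ V, inner ℝ (c₀ + t • c) u ≤ inner ℝ (c₀ + t • c) v := by
  have hin (t : ℝ) : ∀ y, inner ℝ (c₀ + t • c) y = inner ℝ c₀ y + t * inner ℝ c y := fun y => by
    rw [inner_add_left, real_inner_smul_left]
  obtain ⟨w, ⟨hwV, hw⟩, hmin⟩ := Set.exists_min_image {u ∈ V | inner ℝ c v < inner ℝ c u}
    (fun u => (inner ℝ c₀ v - inner ℝ c₀ u) / (inner ℝ c u - inner ℝ c v))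
    (hfin.subset (Set.sep_subset _ _)) hex
  have hw' : 0 < inner ℝ c w - inner ℝ c v := sub_pos.2 hw
  -- Ratio test: each improving `u` ties with `v` at its own ratio, and `t` is the smallest of
  -- these.
  set t := (inner ℝ c₀ v - inner ℝ c₀ w) / (inner ℝ c w - inner ℝ c v) with ht
  have ht0 : 0 ≤ t := div_nonneg (sub_nonneg.2 (h₀ w hwV)) hw'.le
  refine ⟨t, ht0, w, hwV, hw, ?_, fun u hu => ?_⟩
  · have : t * (inner ℝ c w - inner ℝ c v) = inner ℝ c₀ v - inner ℝ c₀ w :=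
      div_mul_cancel₀ _ hw'.ne'
    rw [hin, hin]
    linarith
  · rw [hin, hin]
    rcases lt_or_ge (inner ℝ c v) (inner ℝ c u) with hlt | hge
    · have := (le_div_iff₀ (sub_pos.2 hlt)).1 (hmin u ⟨hu, hlt⟩)
      linarith
    · have := mul_le_mul_of_nonneg_left hge ht0
      linarith [h₀ u hu]

theorem NormallyEquivalent.symm (h : NormallyEquivalent P P') : NormallyEquivalent P' P :=
  fun c => (h c).symm

theorem NormallyEquivalent.sub_mem_vectorSpan (h : NormallyEquivalent P P')
    (hv : v ∈ maxFace P' c) (hw : w ∈ maxFace P' c) : w - v ∈ vectorSpan ℝ (maxFace P c) := by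
  have hd := (h c).direction_eq
  rw [direction_affineSpan, direction_affineSpan] at hd
  rw [hd]
  exact vsub_mem_vectorSpan ℝ hw hv

/-- Parallel affine hulls have the same direction, which is zero for a point. -/
theorem NormallyEquivalent.eq_of_maxFace_eq_singleton (h : NormallyEquivalent P P')
    (hc : maxFace P c = {w'}) (hv : v ∈ maxFace P' c) (hw : w ∈ maxFace P' c) : w = v := by
  have := h.sub_mem_vectorSpan hv hw
  rw [hc, vectorSpan_singleton, Submodule.mem_bot] at this
  exact sub_eq_zero.1 this

theorem NormallyEquivalent.exists_areMaximizers (hfin : V'.Finite) (hne : V'.Nonempty)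
    (h : NormallyEquivalent P (convexHull ℝ V')) (hc : maxFace P c = {v}) :
    ∃ v' ∈ V', AreMaximizers P (convexHull ℝ V') c v v' := by
  obtain ⟨v', hv', hmax⟩ := exists_mem_maxFace hfin hne c
  exact ⟨v', hv', hc, Set.eq_singleton_iff_unique_mem.2
    ⟨hmax, fun y hy => h.eq_of_maxFace_eq_singleton hc hmax hy⟩⟩

/-- The normal cone of a vertex of `P` is contained in the normal cone of the corresponding
vertex of a normally equivalent polytope. -/
theorem NormallyEquivalent.mem_maxFace (hfin : V'.Finite) (hne : V'.Nonempty)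
    (h : NormallyEquivalent P (convexHull ℝ V'))
    (h₀ : AreMaximizers P (convexHull ℝ V') c₀ v v') (hv : v ∈ maxFace P c) :
    v' ∈ maxFace (convexHull ℝ V') c := by
  have hv'V := mem_of_maxFace_eq_singleton hfin hne h₀.2
  have hv' := mem_maxFace_of_eq_singleton h₀.2
  by_contra hnot
  have hex : ∃ u ∈ V', inner ℝ c v' < inner ℝ c u := by
    by_contra! hle
    exact hnot (mem_maxFace_convexHull hv'V hle)
  -- If `v'` fails for `c`, some `c₀ + t • c` has both `v'` and `w` as maximizers, although `v` is
  -- still its only maximizer over `P`.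
  obtain ⟨t, ht, w, hw, hlt, heq, hle⟩ :=
    exists_pivot hfin (fun u hu => hv'.2 u (subset_convexHull ℝ V' hu)) hex
  have h1 := mem_maxFace_convexHull hv'V hle
  have h2 := mem_maxFace_convexHull hw (fun u hu => (hle u hu).trans heq.ge)
  have := h.eq_of_maxFace_eq_singleton (maxFace_add_smul_eq_singleton ht h₀.1 hv) h1 h2
  exact hlt.ne (by rw [this])

/-- The chord lemma: parallel nondegenerate chords of two concentric spheres have endpoints
with equal inner products. -/
theorem inner_eq_inner_of_parallel {μ : ℝ} (hμ : μ ≠ 0) (hvw : ‖v‖ = ‖w‖) (hvw' : ‖v'‖ = ‖w'‖)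
    (h : w' - v' = μ • (w - v)) : inner ℝ w w' = inner ℝ v v' := by
  obtain rfl : w' = v' + μ • (w - v) := by rw [← h]; abel
  have h1 : inner ℝ v v = inner ℝ w w := by
    rw [real_inner_self_eq_norm_sq, real_inner_self_eq_norm_sq, hvw]
  have h2 : inner ℝ v' v' = inner ℝ (v' + μ • (w - v)) (v' + μ • (w - v)) := by
    rw [real_inner_self_eq_norm_sq, real_inner_self_eq_norm_sq, hvw']
  simp only [inner_add_right, inner_add_left, real_inner_smul_left, inner_smul_right,
    inner_sub_left, inner_sub_right, real_inner_comm v' w, real_inner_comm v' v,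
    real_inner_comm v w] at h2 ⊢
  have h3 : μ * (2 * (inner ℝ w v' - inner ℝ v v')
      + μ * (inner ℝ w w - 2 * inner ℝ w v + inner ℝ v v)) = 0 := by
    simp only [real_inner_comm v' w, real_inner_comm v' v, real_inner_comm v w]
    linarith
  have h4 := (mul_eq_zero.1 h3).resolve_left hμ
  simp only [real_inner_comm v' w, real_inner_comm v' v, real_inner_comm v w] at h4 ⊢
  linear_combination h4 / 2 - μ / 2 * h1

end Faces

/-! ### Generic objectives and points on a sphere -/

section Perturbation

variable {d : ℕ} {V : Set (EuclideanSpace ℝ (Fin d))}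

theorem dense_setOf_inner_ne_zero {x : EuclideanSpace ℝ (Fin d)} (hx : x ≠ 0) :
    Dense {c : EuclideanSpace ℝ (Fin d) | inner ℝ c x ≠ 0} := by
  have hcompl : {c : EuclideanSpace ℝ (Fin d) | inner ℝ c x ≠ 0} =
      ((ℝ ∙ x)ᗮ : Set (EuclideanSpace ℝ (Fin d)))ᶜ := by
    ext c
    simp [Submodule.mem_orthogonal_singleton_iff_inner_left]
  rw [hcompl, ← interior_eq_empty_iff_dense_compl]
  by_contra hne
  have htop := Submodule.eq_top_of_nonempty_interior' _ (Set.nonempty_iff_ne_empty.2 hne)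
  have hmem : x ∈ (ℝ ∙ x)ᗮ := htop ▸ Submodule.mem_top
  rw [Submodule.mem_orthogonal_singleton_iff_inner_left] at hmem
  exact hx (inner_self_eq_zero.1 hmem)

/-- An open nonempty set of linear functions has a member vanishing nowhere on a given finite set
of nonzero vectors. -/
theorem exists_mem_forall_inner_ne_zero {U : Set (EuclideanSpace ℝ (Fin d))} (hU : IsOpen U)
    (hne : U.Nonempty) {S : Set (EuclideanSpace ℝ (Fin d))} (hS : S.Finite) (h0 : 0 ∉ S) :
    ∃ c ∈ U, ∀ x ∈ S, inner ℝ c x ≠ 0 := by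
  have hd : Dense (⋂ x ∈ S, {c : EuclideanSpace ℝ (Fin d) | inner ℝ c x ≠ 0}) :=
    dense_biInter_of_isOpen
      (fun x _ => isOpen_ne_fun (continuous_id.inner continuous_const) continuous_const)
      hS.countable fun x hx => dense_setOf_inner_ne_zero fun h => h0 (h ▸ hx)
  obtain ⟨c, hc, hcU⟩ := hd.exists_mem_open hU hne
  exact ⟨c, hcU, by simpa using hc⟩

theorem inner_lt_inner_self_of_norm_eq {v u : EuclideanSpace ℝ (Fin d)} (h : ‖u‖ = ‖v‖)
    (hne : u ≠ v) : inner ℝ v u < inner ℝ v v := by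
  have hpos : 0 < ‖v - u‖ ^ 2 := by
    have := norm_pos_iff.2 (sub_ne_zero.2 hne.symm)
    positivity
  rw [norm_sub_sq_real, h] at hpos
  rw [real_inner_self_eq_norm_sq]
  linarith

/-- No three distinct points of a sphere are collinear. -/
theorem smul_sub_smul_ne_zero {u v w : EuclideanSpace ℝ (Fin d)} (hu : ‖u‖ = ‖v‖)
    (hw : ‖w‖ = ‖v‖) (huw : u ≠ w) (hwv : w ≠ v) {a b : ℝ} (ha : a ≠ 0) (hb : b ≠ 0) :
    a • (w - v) - b • (u - v) ≠ 0 := by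
  intro h
  have hx : u = v + (a / b) • (w - v) := by
    have : u - v = (a / b) • (w - v) := by
      rw [div_eq_inv_mul, mul_smul, sub_eq_zero.1 h, inv_smul_smul₀ hb]
    rw [← this]; abel
  set s := a / b with hs
  have hs0 : s ≠ 0 := div_ne_zero ha hb
  have h1 : 2 * inner ℝ v (w - v) + ‖w - v‖ ^ 2 = 0 := by
    have := norm_add_sq_real v (w - v)
    rw [add_sub_cancel, hw] at this
    linarith
  have h2 : 2 * (s * inner ℝ v (w - v)) + s ^ 2 * ‖w - v‖ ^ 2 = 0 := by
    have := norm_add_sq_real v (s • (w - v))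
    rw [← hx, hu, inner_smul_right, norm_smul, mul_pow, Real.norm_eq_abs, sq_abs] at this
    linarith
  have hpos : ‖w - v‖ ^ 2 ≠ 0 := pow_ne_zero 2 (norm_ne_zero_iff.2 (sub_ne_zero.2 hwv))
  have h3 : s * ((s - 1) * ‖w - v‖ ^ 2) = 0 := by linear_combination h2 - s * h1
  have h4 : s = 1 := sub_eq_zero.1
    ((mul_eq_zero.1 ((mul_eq_zero.1 h3).resolve_left hs0)).resolve_right hpos)
  rw [h4, one_smul, add_sub_cancel] at hx
  exact huw hx

end Perturbation

/-! ### Constancy of the inner product, and vertices of the sum -/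

section Ideal

variable {d : ℕ} {V V' : Set (EuclideanSpace ℝ (Fin d))}
  {c c₀ c₁ v v' w w' : EuclideanSpace ℝ (Fin d)}

/-- Among the objectives maximized at a vertex `v` of an inscribed polytope there is one from which
the pivot towards `c` runs along an edge. -/
theorem exists_edge (hfin : V.Finite) (hV : ∀ u ∈ V, ‖u‖ = 1) (hv : v ∈ V)
    (hex : ∃ u ∈ V, inner ℝ c v < inner ℝ c u) :
    ∃ e, ∃ w ∈ V, inner ℝ c v < inner ℝ c w ∧ v ∈ maxFace (convexHull ℝ V) e ∧
      w ∈ maxFace (convexHull ℝ V) e ∧ maxFace (convexHull ℝ V) e ⊆ convexHull ℝ {v, w} := by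
  set A := {u ∈ V | inner ℝ c v < inner ℝ c u} with hA
  have hAfin : A.Finite := hfin.subset (Set.sep_subset _ _)
  -- If two improving vertices tie with `v` at the same parameter, the starting objective is
  -- orthogonal to the corresponding vector of `S`. These vectors are nonzero because no three
  -- points of a sphere are collinear.
  set S := (fun p : EuclideanSpace ℝ (Fin d) × EuclideanSpace ℝ (Fin d) =>
    (inner ℝ c (p.1 - v) : ℝ) • (p.2 - v) - (inner ℝ c (p.2 - v) : ℝ) • (p.1 - v)) '' A.offDiag
    with hS
  have hS0 : (0 : EuclideanSpace ℝ (Fin d)) ∉ S := by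
    rintro ⟨⟨u, w⟩, hp, h0⟩
    obtain ⟨hu, hw, huw⟩ := Set.mem_offDiag.1 hp
    refine smul_sub_smul_ne_zero ((hV u hu.1).trans (hV v hv).symm)
      ((hV w hw.1).trans (hV v hv).symm) huw ?_ ?_ ?_ h0
    · rintro rfl
      exact lt_irrefl _ hw.2
    · rw [inner_sub_right]
      exact (sub_pos.2 hu.2).ne'
    · rw [inner_sub_right]
      exact (sub_pos.2 hw.2).ne'
  set U := ⋂ u ∈ V \ {v}, {e : EuclideanSpace ℝ (Fin d) | inner ℝ e u < inner ℝ e v} with hU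
  have hUo : IsOpen U := (hfin.subset Set.sdiff_subset).isOpen_biInter fun u _ =>
    isOpen_lt (continuous_id.inner continuous_const) (continuous_id.inner continuous_const)
  -- On a sphere, `v` itself is an objective maximized only at `v`.
  have hvU : v ∈ U := Set.mem_iInter₂.2 fun u hu =>
    inner_lt_inner_self_of_norm_eq ((hV u hu.1).trans (hV v hv).symm) hu.2
  obtain ⟨c₁, hc₁U, hc₁S⟩ := exists_mem_forall_inner_ne_zero hUo ⟨v, hvU⟩
    (hAfin.offDiag.image _) hS0
  have hc₁ : ∀ u ∈ V, u ≠ v → inner ℝ c₁ u < inner ℝ c₁ v := fun u hu huv =>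
    Set.mem_iInter₂.1 hc₁U u ⟨hu, huv⟩
  have hc₁' : ∀ u ∈ V, inner ℝ c₁ u ≤ inner ℝ c₁ v := fun u hu => by
    rcases eq_or_ne u v with rfl | huv
    · exact le_rfl
    · exact (hc₁ u hu huv).le
  obtain ⟨t, ht, w, hwV, hw, heq, hle⟩ := exists_pivot hfin hc₁' hex
  have hvm := mem_maxFace_convexHull hv hle
  have hwm := mem_maxFace_convexHull hwV fun u hu => (hle u hu).trans heq.ge
  refine ⟨c₁ + t • c, w, hwV, hw, hvm, hwm,
    maxFace_subset_convexHull.trans (convexHull_mono ?_)⟩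
  rintro u ⟨hu, hum⟩
  by_contra hnot
  obtain ⟨huv, huw⟩ : u ≠ v ∧ u ≠ w := by simpa using hnot
  have hueq : inner ℝ (c₁ + t • c) u = inner ℝ (c₁ + t • c) v :=
    le_antisymm (hle u hu) (hum.2 v hvm.1)
  simp only [inner_add_left, real_inner_smul_left] at hueq heq
  have hu1 := hc₁ u hu huv
  have huA : inner ℝ c v < inner ℝ c u := by
    by_contra! hge
    have := mul_le_mul_of_nonneg_left hge ht
    linarith
  refine hc₁S _ ⟨(u, w), Set.mem_offDiag.2 ⟨⟨hu, huA⟩, ⟨hwV, hw⟩, huw⟩, rfl⟩ ?_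
  simp only [inner_sub_right, inner_smul_right]
  -- The two tie equations are combined so that `t` cancels.
  linear_combination (inner ℝ c u - inner ℝ c v) * heq - (inner ℝ c w - inner ℝ c v) * hueq

theorem AreMaximizers.swap {Q Q' : Set (EuclideanSpace ℝ (Fin d))}
    (h : AreMaximizers Q Q' c v v') : AreMaximizers Q' Q c v' v :=
  ⟨h.2, h.1⟩

theorem exists_areMaximizers_self (hV : ∀ u ∈ V, ‖u‖ = 1) (hfin' : V'.Finite)
    (hne' : V'.Nonempty) (h : NormallyEquivalent (convexHull ℝ V) (convexHull ℝ V'))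
    (hv : v ∈ V) : ∃ v' ∈ V', AreMaximizers (convexHull ℝ V) (convexHull ℝ V') v v v' :=
  h.exists_areMaximizers hfin' hne' <| maxFace_eq_singleton hv fun u hu huv =>
    inner_lt_inner_self_of_norm_eq ((hV u hu).trans (hV v hv).symm) huv

/-- A simplex step: a vertex not optimal for `c` has a better neighbour, and the inner product of
corresponding vertices does not change along the edge. -/
theorem exists_improving_vertex (hfin : V.Finite) (hne : V.Nonempty) (hV : ∀ u ∈ V, ‖u‖ = 1)
    (hfin' : V'.Finite) (hne' : V'.Nonempty) (hV' : ∀ u ∈ V', ‖u‖ = 1)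
    (h : NormallyEquivalent (convexHull ℝ V) (convexHull ℝ V'))
    (h₀ : AreMaximizers (convexHull ℝ V) (convexHull ℝ V') c₀ v v')
    (hex : ∃ u ∈ V, inner ℝ c v < inner ℝ c u) :
    ∃ c₁, ∃ w ∈ V, ∃ w', AreMaximizers (convexHull ℝ V) (convexHull ℝ V') c₁ w w' ∧
      inner ℝ c v < inner ℝ c w ∧ inner ℝ w w' = inner ℝ v v' := by
  have hv := mem_of_maxFace_eq_singleton hfin hne h₀.1
  have hv' := mem_of_maxFace_eq_singleton hfin' hne' h₀.2
  obtain ⟨e, w, hw, hlt, hve, hwe, hface⟩ := exists_edge hfin hV hv hex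
  obtain ⟨w', hw', h₁⟩ := exists_areMaximizers_self hV hfin' hne' h hw
  refine ⟨w, w, hw, w', h₁, hlt, ?_⟩
  have hmem := h.sub_mem_vectorSpan (h.mem_maxFace hfin' hne' h₀ hve)
    (h.mem_maxFace hfin' hne' h₁ hwe)
  have hmem' : w' - v' ∈ vectorSpan ℝ ({v, w} : Set (EuclideanSpace ℝ (Fin d))) := by
    rw [← direction_affineSpan, ← affineSpan_convexHull, direction_affineSpan]
    exact vectorSpan_mono ℝ hface hmem
  obtain ⟨μ, hμ⟩ := mem_vectorSpan_pair_rev.1 hmem'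
  rw [vsub_eq_sub] at hμ
  refine inner_eq_inner_of_parallel (μ := μ) ?_ ((hV v hv).trans (hV w hw).symm)
    ((hV' v' hv').trans (hV' w' hw').symm) hμ.symm
  -- If `μ = 0`, then `w' = v'`, so `w` would also maximize `c₀`, whose only maximizer is `v`.
  rintro rfl
  rw [zero_smul] at hμ
  have hwv' : w' = v' := sub_eq_zero.1 hμ.symm
  have hwm := h.symm.mem_maxFace hfin hne h₁.swap (hwv' ▸ mem_maxFace_of_eq_singleton h₀.2)
  rw [h₀.1] at hwm
  exact hlt.ne (by rw [Set.mem_singleton_iff.1 hwm])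

/-- Among the finitely many vertices sharing the inner product of `v`, one that is best for `c₁`
admits no improving simplex step, so it is `w`. -/
theorem AreMaximizers.inner_eq (hfin : V.Finite) (hne : V.Nonempty) (hV : ∀ u ∈ V, ‖u‖ = 1)
    (hfin' : V'.Finite) (hne' : V'.Nonempty) (hV' : ∀ u ∈ V', ‖u‖ = 1)
    (h : NormallyEquivalent (convexHull ℝ V) (convexHull ℝ V'))
    (h₀ : AreMaximizers (convexHull ℝ V) (convexHull ℝ V') c₀ v v')
    (h₁ : AreMaximizers (convexHull ℝ V) (convexHull ℝ V') c₁ w w') :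
    inner ℝ v v' = inner ℝ w w' := by
  set B := {x ∈ V | ∃ e x', AreMaximizers (convexHull ℝ V) (convexHull ℝ V') e x x' ∧
    inner ℝ x x' = inner ℝ v v'} with hB
  have hvB : v ∈ B := ⟨mem_of_maxFace_eq_singleton hfin hne h₀.1, c₀, v', h₀, rfl⟩
  obtain ⟨x, ⟨hxV, e, x', hx, hxin⟩, hmax⟩ := Set.exists_max_image B (fun u => inner ℝ c₁ u)
    (hfin.subset (Set.sep_subset _ _)) ⟨v, hvB⟩
  have hwV := mem_of_maxFace_eq_singleton hfin hne h₁.1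
  have hxw : x = w := by
    by_contra hxw
    obtain ⟨f, y, hy, y', hyy, hlt, hin⟩ := exists_improving_vertex hfin hne hV hfin' hne' hV' h hx
      ⟨w, hwV, inner_lt_of_maxFace_eq_singleton h₁.1 (subset_convexHull ℝ V hxV) hxw⟩
    exact (hmax y ⟨hy, f, y', hyy, hin.trans hxin⟩).not_gt hlt
  subst hxw
  -- The partner of a vertex does not depend on the objective that exposes it.
  have hx' := h.mem_maxFace hfin' hne' hx (mem_maxFace_of_eq_singleton h₁.1)
  rw [h₁.2] at hx'
  rw [← hxin, Set.mem_singleton_iff.1 hx']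

/-- A vertex of the Minkowski sum of two polytopes is the sum of the unique maximizers of a
generic linear function. -/
theorem exists_areMaximizers_of_mem_extremePoints (hfin : V.Finite) (hfin' : V'.Finite)
    {x : EuclideanSpace ℝ (Fin d)} (hx : x ∈ (convexHull ℝ (V + V')).extremePoints ℝ) :
    ∃ c v v', AreMaximizers (convexHull ℝ V) (convexHull ℝ V') c v v' ∧ v + v' = x := by
  obtain ⟨a, ha, b, hb, hab⟩ := Set.mem_add.1 (extremePoints_convexHull_subset hx)
  have hxW : x ∉ convexHull ℝ ((V + V') \ {x}) := fun hmem =>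
    (((convex_convexHull ℝ _).mem_extremePoints_iff_mem_sdiff_convexHull_sdiff.1 hx).2 <|
      convexHull_mono (Set.sdiff_subset_sdiff_left (subset_convexHull ℝ _)) hmem)
  obtain ⟨f, r, hf, hfx⟩ := geometric_hahn_banach_closed_point (convex_convexHull ℝ _)
    (((hfin.add hfin').subset Set.sdiff_subset).isClosed_convexHull ℝ) hxW
  set c := (InnerProductSpace.toDual ℝ (EuclideanSpace ℝ (Fin d))).symm f with hc
  have hcf : ∀ y, inner ℝ c y = f y := fun y => InnerProductSpace.toDual_symm_apply
  have hlt : ∀ y ∈ V + V', y ≠ x → inner ℝ c y < inner ℝ c x := fun y hy hyx => by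
    rw [hcf, hcf]
    exact (hf y (subset_convexHull ℝ _ ⟨hy, hyx⟩)).trans hfx
  refine ⟨c, a, b, ⟨maxFace_eq_singleton ha fun u hu hua => ?_,
    maxFace_eq_singleton hb fun u hu hub => ?_⟩, hab⟩
  · have := hlt (u + b) (Set.add_mem_add hu hb) (by rw [← hab]; simpa using hua)
    rw [← hab, inner_add_right, inner_add_right] at this
    linarith
  · have := hlt (a + u) (Set.add_mem_add ha hu) (by rw [← hab]; simpa using hub)
    rw [← hab, inner_add_right, inner_add_right] at this
    linarith

theorem IsIdealPolytope.exists_eq_convexHull {Q : Set (EuclideanSpace ℝ (Fin d))}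
    (hQ : IsIdealPolytope Q) : ∃ V : Set (EuclideanSpace ℝ (Fin d)), V.Finite ∧ V.Nonempty ∧
      (∀ u ∈ V, ‖u‖ = 1) ∧ Q = convexHull ℝ V := by
  obtain ⟨s, hs, hne, rfl⟩ := hQ.isPolytope
  have hfin : ((convexHull ℝ s).extremePoints ℝ).Finite :=
    hs.subset extremePoints_convexHull_subset
  have heq : convexHull ℝ s = convexHull ℝ ((convexHull ℝ s).extremePoints ℝ) := by
    conv_lhs => rw [← closure_convexHull_extremePoints (hs.isCompact_convexHull ℝ)
      (convex_convexHull ℝ s)]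
    exact (hfin.isClosed_convexHull ℝ).closure_eq
  refine ⟨_, hfin, ?_, fun u hu => by simpa using hQ.vertices_subset_sphere hu, heq⟩
  rw [← convexHull_nonempty_iff (𝕜 := ℝ), ← heq]
  exact hne.convexHull

theorem isIdealPolytope_convexHull (hfin : V.Finite) (hne : V.Nonempty)
    (hV : ∀ u ∈ (convexHull ℝ V).extremePoints ℝ, ‖u‖ = 1) : IsIdealPolytope (convexHull ℝ V) := by
  refine ⟨⟨V, hfin, hne, rfl⟩, ?_, fun u hu => by simpa using hV u hu⟩
  rw [← closure_convexHull_extremePoints (hfin.isCompact_convexHull ℝ) (convex_convexHull ℝ V)]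
  refine closure_minimal (convexHull_min (fun u hu => ?_) (convex_closedBall 0 1))
    Metric.isClosed_closedBall
  simpa using (hV u hu).le

end Ideal

end IdealSum

/-! ### The common angle and the rescaled Minkowski sum -/

theorem corollary1p4 {d : ℕ} (Q Q' : Set (EuclideanSpace ℝ (Fin d)))
    (hQ : IdealSum.IsIdealPolytope Q) (hQ' : IdealSum.IsIdealPolytope Q')
    (hQQ' : IdealSum.NormallyEquivalent Q Q')
    -- the degenerate case of two antipodal one-point sets (where the angle would be `π`)
    (hne : ¬ ∃ x : EuclideanSpace ℝ (Fin d), Q = {x} ∧ Q' = {-x}) :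
    ∃ θ ∈ Set.Ico 0 Real.pi,
      (∃ c q q' : EuclideanSpace ℝ (Fin d), IdealSum.AreMaximizers Q Q' c q q') ∧
      (∀ c q q' : EuclideanSpace ℝ (Fin d), IdealSum.AreMaximizers Q Q' c q q' →
        InnerProductGeometry.angle q q' = θ) ∧
      IdealSum.IsIdealPolytope ((1 / Real.sqrt (2 + 2 * Real.cos θ)) • (Q + Q')) := by
  obtain ⟨V, hfin, hVne, hV, rfl⟩ := hQ.exists_eq_convexHull
  obtain ⟨V', hfin', hVne', hV', rfl⟩ := hQ'.exists_eq_convexHull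
  obtain ⟨p, hp⟩ := id hVne
  obtain ⟨p', hp', hpp⟩ := IdealSum.exists_areMaximizers_self hV hfin' hVne' hQQ' hp
  have hinner : ∀ c q q', IdealSum.AreMaximizers (convexHull ℝ V) (convexHull ℝ V') c q q' →
      inner ℝ q q' = inner ℝ p p' := fun c q q' h =>
    h.inner_eq hfin hVne hV hfin' hVne' hV' hQQ' hpp
  have hangle : ∀ c q q', IdealSum.AreMaximizers (convexHull ℝ V) (convexHull ℝ V') c q q' →
      InnerProductGeometry.angle q q' = InnerProductGeometry.angle p p' := fun c q q' h => by
    unfold InnerProductGeometry.angle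
    rw [hinner c q q' h, hV q (IdealSum.mem_of_maxFace_eq_singleton hfin hVne h.1),
      hV' q' (IdealSum.mem_of_maxFace_eq_singleton hfin' hVne' h.2), hV p hp, hV' p' hp']
  have hcos : Real.cos (InnerProductGeometry.angle p p') = inner ℝ p p' := by
    rw [InnerProductGeometry.cos_angle, hV p hp, hV' p' hp']
    simp
  have hneg : ∀ q ∈ V, ∀ q' ∈ V', inner ℝ q q' = (-1 : ℝ) → q' = -q := by
    intro q hq q' hq' h
    have := norm_add_sq_real q q'
    rw [h, hV q hq, hV' q' hq'] at this
    have h0 : q + q' = 0 := by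
      rw [← norm_eq_zero, ← sq_eq_zero_iff]
      linarith
    exact (neg_eq_of_add_eq_zero_right h0).symm
  have hne1 : inner ℝ p p' ≠ (-1 : ℝ) := by
    intro h1
    have hanti : ∀ q ∈ V, ∃ q' ∈ V', q' = -q ∧
        IdealSum.AreMaximizers (convexHull ℝ V) (convexHull ℝ V') q q q' := fun q hq => by
      obtain ⟨q', hq', hqq⟩ := IdealSum.exists_areMaximizers_self hV hfin' hVne' hQQ' hq
      exact ⟨q', hq', hneg q hq q' hq' ((hinner _ _ _ hqq).trans h1), hqq⟩
    have hp1 : p' = -p := hneg p hp p' hp' h1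
    -- For another `q ∈ V`, the point `-q` lies in `V'` and beats `p' = -p` for the objective `p`.
    have hsub : V = {p} := by
      refine Set.eq_singleton_iff_unique_mem.2 ⟨hp, fun q hq => ?_⟩
      by_contra hqp
      obtain ⟨q', hq', rfl, -⟩ := hanti q hq
      have h2 := (IdealSum.mem_maxFace_of_eq_singleton hpp.2).2 _ (subset_convexHull ℝ V' hq')
      have h3 := IdealSum.inner_lt_inner_self_of_norm_eq ((hV q hq).trans (hV p hp).symm) hqp
      rw [hp1, inner_neg_right, inner_neg_right] at h2
      linarith
    refine hne ⟨p, by rw [hsub, convexHull_singleton], ?_⟩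
    -- The zero objective exposes the whole polytope, so normal equivalence makes the second one a
    -- point too.
    have h0 : ∀ P : Set (EuclideanSpace ℝ (Fin d)), IdealSum.maxFace P 0 = P := fun P => by
      simp [IdealSum.maxFace]
    refine Set.eq_singleton_iff_unique_mem.2
      ⟨hp1 ▸ subset_convexHull ℝ V' hp', fun y hy => ?_⟩
    refine hQQ'.eq_of_maxFace_eq_singleton (c := 0) (w' := p) ?_ ?_ ?_
    · rw [h0, hsub, convexHull_singleton]
    · rw [h0]
      exact hp1 ▸ subset_convexHull ℝ V' hp'
    · rwa [h0]
  have hgt : (-1 : ℝ) < inner ℝ p p' :=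
    lt_of_le_of_ne (hcos ▸ Real.neg_one_le_cos _) hne1.symm
  refine ⟨InnerProductGeometry.angle p p', ⟨InnerProductGeometry.angle_nonneg _ _,
    lt_of_le_of_ne (InnerProductGeometry.angle_le_pi _ _) fun hpi => ?_⟩, ⟨p, p, p', hpp⟩,
    hangle, ?_⟩
  · rw [hpi, Real.cos_pi] at hcos
    exact hne1 hcos.symm
  have hpos : 0 < 2 + 2 * (inner ℝ p p' : ℝ) := by linarith
  have hsqrt := Real.sqrt_pos.2 hpos
  rw [hcos, ← convexHull_add, ← convexHull_smul]
  refine IdealSum.isIdealPolytope_convexHull ((hfin.add hfin').smul_set)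
    ((hVne.add hVne').smul_set) fun u hu => ?_
  set r : ℝ := 1 / √(2 + 2 * inner ℝ p p') with hr
  have hr0 : r ≠ 0 := (one_div_pos.2 hsqrt).ne'
  -- Scaling by `r ≠ 0` is a linear equivalence, so it carries extreme points to extreme points.
  rw [convexHull_smul, show r • convexHull ℝ (V + V') =
    LinearEquiv.smulOfNeZero ℝ (EuclideanSpace ℝ (Fin d)) r hr0 '' convexHull ℝ (V + V') from rfl,
    ← image_extremePoints] at hu
  obtain ⟨x, hx, rfl⟩ := hu
  obtain ⟨c, q, q', hqq, rfl⟩ :=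
    IdealSum.exists_areMaximizers_of_mem_extremePoints hfin hfin' hx
  have hnorm : ‖q + q'‖ = √(2 + 2 * inner ℝ p p') := by
    rw [eq_comm, Real.sqrt_eq_iff_eq_sq hpos.le (norm_nonneg _), norm_add_sq_real,
      hinner c q q' hqq, hV q (IdealSum.mem_of_maxFace_eq_singleton hfin hVne hqq.1),
      hV' q' (IdealSum.mem_of_maxFace_eq_singleton hfin' hVne' hqq.2)]
    ring
  rw [LinearEquiv.smulOfNeZero_apply, norm_smul, hnorm, hr, Real.norm_of_nonneg (one_div_pos.2 hsqrt).le,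
    one_div_mul_cancel hsqrt.ne']
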